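/- Let $A$ be a finite set and let $a_1,a_2,a_3,a_4\in A$ be not necessarily distinct letters. Let $S$ be the monoid (respectively, the semigroup) defined by the monoid (respectively, semigroup) presentation $\langle A \mid a_1a_2=a_3a_4\rangle$. For a monoid (respectively, semigroup) endomorphism $\varphi$ of $S$, let $\mathrm{Per}(\varphi)=\{x\in S : \varphi^n(x)=x \text{ for some } n\ge 1\}$, which is a submonoid (respectively, a possibly empty subsemigroup) of $S$; the period of $x\in\mathrm{Per}(\varphi)$ is the least $n\ge 1$ with $\varphi^n(x)=x$. Then: (i) for every endomorphism $\varphi$ of $S$, $\mathrm{Per}(\varphi)$ is finitely generated as a submonoid (respectively, as a subsemigroup, where the empty subsemigroup counts as finitely generated); (ii) for every endomorphism $\varphi$ of $S$, there exists a constant $R_\varphi>0$ such that every $x\in\mathrm{Per}(\varphi)$ has period at most $R_\varphi$. -/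

import Mathlib

/-- The subsemigroup `Per φ` of periodic points of a semigroup endomorphism `φ`: all `x` with
`φ^n x = x` for some `n ≥ 1`. It may be empty. -/
def perSubsemigroup {S : Type*} [Semigroup S] (φ : S →ₙ* S) : Subsemigroup S where
  carrier := {x | ∃ n : ℕ, 1 ≤ n ∧ φ^[n] x = x}
  mul_mem' := by
    rintro x y ⟨m, hm, hx⟩ ⟨n, hn, hy⟩
    refine ⟨m * n, Nat.mul_pos hm hn, ?_⟩
    rw [iterate_map_mul]
    have h1 : φ^[m * n] x = x := Function.IsPeriodicPt.mul_const (f := φ) (m := m) hx n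
    have h2 : φ^[m * n] y = y := Function.IsPeriodicPt.const_mul (f := φ) (m := n) hy m
    rw [h1, h2]

/-- The submonoid `Per φ` of periodic points of a monoid endomorphism `φ`. -/
def perSubmonoid {M : Type*} [Monoid M] (φ : M →* M) : Submonoid M where
  toSubsemigroup := perSubsemigroup (φ : M →ₙ* M)
  one_mem' := ⟨1, le_rfl, map_one φ⟩

/-- A subsemigroup is finitely generated if it is generated by a finite, possibly empty, set. -/
def SubsemigroupFG {S : Type*} [Semigroup S] (T : Subsemigroup S) : Prop :=
  ∃ F : Finset S, Subsemigroup.closure (F : Set S) = T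

/-- The semigroup presented by generators `A` and relations `rels`: the quotient of the free
semigroup on `A` by the congruence generated by `rels`. -/
def PresentedSemigroup {A : Type*} (rels : FreeSemigroup A → FreeSemigroup A → Prop) : Type _ :=
  (conGen rels).Quotient

instance {A : Type*} (rels : FreeSemigroup A → FreeSemigroup A → Prop) :
    Semigroup (PresentedSemigroup rels) :=
  inferInstanceAs (Semigroup (conGen rels).Quotient)

/-- The monoid defined by the presentation `⟨A ∣ a₁ a₂ = a₃ a₄⟩`. -/
abbrev TwoLetterMonoid {A : Type*} (a₁ a₂ a₃ a₄ : A) : Type _ :=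
  PresentedMonoid (fun u v : FreeMonoid A =>
    u = FreeMonoid.of a₁ * FreeMonoid.of a₂ ∧ v = FreeMonoid.of a₃ * FreeMonoid.of a₄)

/-- The semigroup defined by the presentation `⟨A ∣ a₁ a₂ = a₃ a₄⟩`. -/
abbrev TwoLetterSemigroup {A : Type*} (a₁ a₂ a₃ a₄ : A) : Type _ :=
  PresentedSemigroup (fun u v : FreeSemigroup A =>
    u = FreeSemigroup.of a₁ * FreeSemigroup.of a₂ ∧
      v = FreeSemigroup.of a₃ * FreeSemigroup.of a₄)

/-! The relation preserves word length, so length is additive on `S` with finite sublevel sets, and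
an orbit is finite exactly when its lengths are bounded. Factors of an element with finite orbit
therefore have finite orbits, so such an element is a product of generators from the finite set `B`
of generators with finite orbit. Some power `φ^N` is idempotent on `B`, hence on all these products.
Periodic points have finite orbits, so `φ^N` fixes them all: `N` bounds the periods and `φ^N(B)`
generates `Per φ`. -/

theorem exists_iterate_idempotent_of_finite_orbit {S : Type*} (f : S → S) {G : Set S}
    (hG : G.Finite) (h : ∀ g ∈ G, (Set.range fun m : ℕ => f^[m] g).Finite) :
    ∃ N : ℕ, 0 < N ∧ ∀ g ∈ G, f^[N] (f^[N] g) = f^[N] g := by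
  -- Allowing every positive multiple of `n` lets exponents for different points be multiplied
  -- together.
  have key : ∀ g : S, (Set.range fun m : ℕ => f^[m] g).Finite →
      ∃ n : ℕ, 0 < n ∧ ∀ k : ℕ, 0 < k → f^[n * k] (f^[n * k] g) = f^[n * k] g := by
    intro g hg
    obtain ⟨i, -, j, -, hij, he⟩ := Set.infinite_univ.exists_lt_map_eq_of_mapsTo
      (f := fun m : ℕ => f^[m] g) (fun m _ => Set.mem_range_self m) hg
    have hper : ∀ m, i ≤ m → Function.IsPeriodicPt f (j - i) (f^[m] g) := by
      intro m hm
      have h0 : Function.IsPeriodicPt f (j - i) (f^[i] g) := by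
        change f^[j - i] (f^[i] g) = f^[i] g
        rw [← Function.iterate_add_apply, Nat.sub_add_cancel hij.le]
        exact he.symm
      have := h0.apply_iterate (m - i)
      rwa [← Function.iterate_add_apply, Nat.sub_add_cancel hm] at this
    -- A multiple of the eventual period `j - i` lying past the preperiod `i`; the factor `i + 1`
    -- keeps it positive when `i = 0`.
    refine ⟨(j - i) * (i + 1), Nat.mul_pos (Nat.sub_pos_of_lt hij) i.succ_pos, fun k hk => ?_⟩
    have hle : i ≤ (j - i) * (i + 1) * k := by
      have h1 : 1 ≤ j - i := Nat.sub_pos_of_lt hij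
      calc i ≤ 1 * (i + 1) * 1 := by omega
        _ ≤ (j - i) * (i + 1) * k := by gcongr; exact hk
    have := (hper _ hle).mul_const ((i + 1) * k)
    rwa [← mul_assoc] at this
  induction G, hG using Set.Finite.induction_on with
  | empty => exact ⟨1, one_pos, by simp⟩
  | @insert a s _ _ ih =>
    obtain ⟨N, hN, hs⟩ := ih fun g hg => h g (Set.mem_insert_of_mem _ hg)
    obtain ⟨n, hn, ha⟩ := key a (h a (Set.mem_insert _ _))
    refine ⟨n * N, Nat.mul_pos hn hN, ?_⟩
    rintro g (rfl | hg)
    · exact ha N hN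
    · have h0 : Function.IsPeriodicPt f N (f^[N] g) := hs g hg
      obtain ⟨m, rfl⟩ : ∃ m, n = m + 1 := ⟨n - 1, by omega⟩
      have h1 : f^[(m + 1) * N] g = f^[N] g := by
        rw [add_mul, one_mul, Function.iterate_add_apply]
        exact h0.const_mul m
      rw [h1]
      exact h0.const_mul (m + 1)

theorem finite_orbit_of_isPeriodicPt {S : Type*} {f : S → S} {n : ℕ} (hn : 0 < n) {x : S}
    (hx : Function.IsPeriodicPt f n x) : (Set.range fun m : ℕ => f^[m] x).Finite := by
  refine ((Set.finite_Iio n).image fun m => f^[m] x).subset ?_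
  rintro _ ⟨m, rfl⟩
  exact ⟨m % n, Nat.mod_lt _ hn, hx.iterate_mod_apply m⟩

/-- In a finitely generated semigroup with an additive length with finite sublevel sets, the
periodic points of an endomorphism form a finitely generated subsemigroup and are all fixed by
a single positive power of the endomorphism. -/
theorem perSubsemigroup_fg_and_bounded_of_length {S : Type*} [Semigroup S] (ℓ : S → ℕ)
    (hmul : ∀ x y, ℓ (x * y) = ℓ x + ℓ y) (hfin : ∀ k, {x | ℓ x ≤ k}.Finite)
    {G : Set S} (hG : G.Finite) (hgen : Subsemigroup.closure G = ⊤) (φ : S →ₙ* S) :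
    SubsemigroupFG (perSubsemigroup φ) ∧
      ∃ R : ℕ, 0 < R ∧ ∀ x ∈ perSubsemigroup φ, Function.minimalPeriod φ x ≤ R := by
  -- Applied below with `y` a factor of `x`: by additivity no iterate of a factor is longer than
  -- that of the product.
  have hmono : ∀ x y : S, (∀ m, ℓ (φ^[m] y) ≤ ℓ (φ^[m] x)) →
      (Set.range fun m : ℕ => φ^[m] x).Finite → (Set.range fun m : ℕ => φ^[m] y).Finite := by
    intro x y hle hx
    obtain ⟨k, hk⟩ := (hx.image ℓ).bddAbove
    refine (hfin k).subset ?_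
    rintro _ ⟨m, rfl⟩
    exact (hle m).trans (hk ⟨_, ⟨m, rfl⟩, rfl⟩)
  set B : Set S := {g ∈ G | (Set.range fun m : ℕ => φ^[m] g).Finite} with hB
  have hBfin : B.Finite := hG.subset fun _ h => h.1
  obtain ⟨N, hN, hidem⟩ := exists_iterate_idempotent_of_finite_orbit φ hBfin fun _ h => h.2
  have hclos : ∀ x : S, (Set.range fun m : ℕ => φ^[m] x).Finite →
      φ^[N] (φ^[N] x) = φ^[N] x ∧ φ^[N] x ∈ Subsemigroup.closure (φ^[N] '' B) := by
    intro x
    have hx : x ∈ Subsemigroup.closure G := hgen ▸ Subsemigroup.mem_top x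
    induction hx using Subsemigroup.closure_induction with
    | mem x hx =>
      exact fun h => ⟨hidem x ⟨hx, h⟩, Subsemigroup.subset_closure ⟨x, ⟨hx, h⟩, rfl⟩⟩
    | mul x y _ _ ihx ihy =>
      intro h
      obtain ⟨hx1, hx2⟩ := ihx (hmono _ _ (fun m => by
        rw [iterate_map_mul, hmul]; exact Nat.le_add_right _ _) h)
      obtain ⟨hy1, hy2⟩ := ihy (hmono _ _ (fun m => by
        rw [iterate_map_mul, hmul]; exact Nat.le_add_left _ _) h)
      rw [iterate_map_mul, iterate_map_mul, hx1, hy1]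
      exact ⟨rfl, mul_mem hx2 hy2⟩
  have hper : ∀ x ∈ perSubsemigroup φ,
      φ^[N] x = x ∧ φ^[N] x ∈ Subsemigroup.closure (φ^[N] '' B) := by
    rintro x ⟨n, hn, hx⟩
    obtain ⟨h1, h2⟩ := hclos x (finite_orbit_of_isPeriodicPt hn hx)
    refine ⟨?_, h2⟩
    -- With `n` a period of `x`, `φ^(nN)` fixes `x`, while idempotency at `x` collapses it to `φ^N`.
    obtain ⟨m, rfl⟩ : ∃ m, n = m + 1 := ⟨n - 1, by omega⟩
    have h3 : φ^[(m + 1) * N] x = x := Function.IsPeriodicPt.mul_const (f := φ) hx N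
    have h4 : φ^[(m + 1) * N] x = φ^[N] x := by
      rw [add_mul, one_mul, Function.iterate_add_apply]
      exact Function.IsPeriodicPt.const_mul (f := φ) h1 m
    rw [← h4, h3]
  refine ⟨⟨(hBfin.image φ^[N]).toFinset, ?_⟩, N, hN, fun x hx =>
    Function.IsPeriodicPt.minimalPeriod_le hN (hper x hx).1⟩
  rw [Set.Finite.coe_toFinset]
  refine le_antisymm (Subsemigroup.closure_le.2 ?_) fun x hx => ?_
  · rintro _ ⟨g, hg, rfl⟩
    exact ⟨N, hN, hidem g hg⟩
  · have := hper x hx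
    rw [← this.1]
    exact this.2

/-- If all relations preserve word length, the periodic points of an endomorphism of the presented
monoid form a finitely generated submonoid and have bounded periods. -/
theorem PresentedMonoid.perSubmonoid_fg_and_bounded {A : Type*} [Finite A]
    (rels : FreeMonoid A → FreeMonoid A → Prop) (hrels : ∀ u v, rels u v → u.length = v.length)
    (φ : PresentedMonoid rels →* PresentedMonoid rels) :
    (perSubmonoid φ).FG ∧
      ∃ R : ℕ, 0 < R ∧ ∀ x ∈ perSubmonoid φ, Function.minimalPeriod φ x ≤ R := by
  have hlen : ∀ w : FreeMonoid A,
      FreeMonoid.lift (fun _ : A => Multiplicative.ofAdd 1) w = Multiplicative.ofAdd w.length := by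
    intro w
    induction w using FreeMonoid.inductionOn' with
    | one => rfl
    | of_mul a w ih =>
      rw [map_mul, ih, FreeMonoid.lift_eval_of, FreeMonoid.length_mul, FreeMonoid.length_of]
      rfl
  let L : PresentedMonoid rels →* Multiplicative ℕ :=
    PresentedMonoid.lift (fun _ => Multiplicative.ofAdd 1) fun u v h => by
      rw [hlen, hlen, hrels u v h]
  have hL : ∀ w, L (PresentedMonoid.mk rels w) = Multiplicative.ofAdd w.length := fun w => hlen w
  -- The identity is adjoined because the monoid must be generated as a semigroup.
  have hG : (insert 1 (Set.range (PresentedMonoid.of rels))).Finite :=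
    (Set.finite_range _).insert 1
  obtain ⟨⟨F, hF⟩, hR⟩ := perSubsemigroup_fg_and_bounded_of_length
    (fun x => (L x).toAdd) (fun x y => by rw [map_mul, toAdd_mul])
    (fun k => by
      refine ((List.finite_length_le A k).image fun w => PresentedMonoid.mk rels
        (FreeMonoid.ofList w)).subset ?_
      intro x hx
      obtain ⟨w, rfl⟩ := PresentedMonoid.surjective_mk x
      have hw : (L (PresentedMonoid.mk rels w)).toAdd ≤ k := hx
      rw [hL] at hw
      exact ⟨w.toList, hw, rfl⟩) hG
    (by
      refine eq_top_iff.2 fun x _ => ?_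
      obtain ⟨w, rfl⟩ := PresentedMonoid.surjective_mk x
      induction w using FreeMonoid.inductionOn' with
      | one => exact Subsemigroup.subset_closure (Or.inl rfl)
      | of_mul a w ih =>
        rw [map_mul]
        exact mul_mem (Subsemigroup.subset_closure (Or.inr ⟨a, rfl⟩)) (ih trivial))
    (φ : PresentedMonoid rels →ₙ* PresentedMonoid rels)
  refine ⟨⟨F, le_antisymm (Submonoid.closure_le.2 fun x hx => ?_) fun x hx => ?_⟩, hR⟩
  · change x ∈ perSubsemigroup (φ : PresentedMonoid rels →ₙ* PresentedMonoid rels)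
    rw [← hF]
    exact Subsemigroup.subset_closure hx
  · replace hx : x ∈ Subsemigroup.closure (F : Set (PresentedMonoid rels)) := hF ▸ hx
    exact (Subsemigroup.closure_le (S := (Submonoid.closure (F : Set (PresentedMonoid rels))).toSubsemigroup)).2
      Submonoid.subset_closure hx

/-- If all relations preserve word length, the periodic points of an endomorphism of the presented
semigroup form a finitely generated subsemigroup and have bounded periods. -/
theorem PresentedSemigroup.perSubsemigroup_fg_and_bounded {A : Type*} [Finite A]
    (rels : FreeSemigroup A → FreeSemigroup A → Prop)
    (hrels : ∀ u v, rels u v → u.length = v.length)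
    (φ : PresentedSemigroup rels →ₙ* PresentedSemigroup rels) :
    SubsemigroupFG (perSubsemigroup φ) ∧
      ∃ R : ℕ, 0 < R ∧ ∀ x ∈ perSubsemigroup φ, Function.minimalPeriod φ x ≤ R := by
  have hle : ∀ u v, conGen rels u v → u.length = v.length := by
    intro u v h
    induction h with
    | of x y h => exact hrels x y h
    | refl x => rfl
    | symm _ ih => exact ih.symm
    | trans _ _ ih1 ih2 => exact ih1.trans ih2
    | mul _ _ ih1 ih2 => rw [FreeSemigroup.length_mul, FreeSemigroup.length_mul, ih1, ih2]
  let q : FreeSemigroup A → PresentedSemigroup rels := fun w => ((w : (conGen rels).Quotient))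
  have hq : Function.Surjective q := Quotient.mk''_surjective
  let ℓ : PresentedSemigroup rels → ℕ := fun x => Quotient.liftOn' x FreeSemigroup.length hle
  refine perSubsemigroup_fg_and_bounded_of_length ℓ ?_ (fun k => ?_)
    (Set.finite_range fun a => q (FreeSemigroup.of a)) ?_ φ
  · intro x y
    obtain ⟨u, rfl⟩ := hq x
    obtain ⟨v, rfl⟩ := hq y
    exact FreeSemigroup.length_mul u v
  · have hfin : {w : FreeSemigroup A | w.length ≤ k}.Finite := by
      refine ((List.finite_length_le A k).preimage
        (f := fun w : FreeSemigroup A => w.head :: w.tail) ?_).subset ?_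
      · intro u _ v _ h
        exact FreeSemigroup.ext (List.cons.inj h).1 (List.cons.inj h).2
      · intro w hw
        exact hw
    refine (hfin.image q).subset fun x hx => ?_
    obtain ⟨w, rfl⟩ := hq x
    exact ⟨w, hx, rfl⟩
  · refine eq_top_iff.2 fun x _ => ?_
    obtain ⟨w, rfl⟩ := hq x
    induction w using FreeSemigroup.recOnMul with
    | ih1 a => exact Subsemigroup.subset_closure ⟨a, rfl⟩
    | ih2 a w iha ihw => exact mul_mem (iha trivial) (ihw trivial)

theorem mainTheorem2 {A : Type*} [Finite A] (a₁ a₂ a₃ a₄ : A) :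
    ((∀ φ : TwoLetterMonoid a₁ a₂ a₃ a₄ →* TwoLetterMonoid a₁ a₂ a₃ a₄,
        (perSubmonoid φ).FG) ∧
      (∀ φ : TwoLetterMonoid a₁ a₂ a₃ a₄ →* TwoLetterMonoid a₁ a₂ a₃ a₄,
        ∃ R : ℕ, 0 < R ∧ ∀ x ∈ perSubmonoid φ, Function.minimalPeriod φ x ≤ R)) ∧
    ((∀ φ : TwoLetterSemigroup a₁ a₂ a₃ a₄ →ₙ* TwoLetterSemigroup a₁ a₂ a₃ a₄,
        SubsemigroupFG (perSubsemigroup φ)) ∧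
      (∀ φ : TwoLetterSemigroup a₁ a₂ a₃ a₄ →ₙ* TwoLetterSemigroup a₁ a₂ a₃ a₄,
        ∃ R : ℕ, 0 < R ∧ ∀ x ∈ perSubsemigroup φ, Function.minimalPeriod φ x ≤ R)) := by
  have hM := PresentedMonoid.perSubmonoid_fg_and_bounded (fun u v : FreeMonoid A =>
    u = FreeMonoid.of a₁ * FreeMonoid.of a₂ ∧ v = FreeMonoid.of a₃ * FreeMonoid.of a₄)
    (by rintro _ _ ⟨rfl, rfl⟩; rfl)
  have hS := PresentedSemigroup.perSubsemigroup_fg_and_bounded (fun u v : FreeSemigroup A =>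
    u = FreeSemigroup.of a₁ * FreeSemigroup.of a₂ ∧
      v = FreeSemigroup.of a₃ * FreeSemigroup.of a₄) (by rintro _ _ ⟨rfl, rfl⟩; rfl)
  exact ⟨⟨fun φ => (hM φ).1, fun φ => (hM φ).2⟩, fun φ => (hS φ).1, fun φ => (hS φ).2⟩
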